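/- Let $\Sigma=\{0,1\}$ and encode a pair of strings $x,y\in\Sigma^*$ as the string $\langle x,y\rangle = x_1x_1x_2x_2\cdots x_{|x|}x_{|x|}\,01\,y_1y_1y_2y_2\cdots y_{|y|}y_{|y|}\in\Sigma^*$. Let $\mathrm{PEq}$ (respectively $\mathrm{NPEq}$) be the class of equivalence relations $R$ on $\Sigma^*$ whose induced language $\{\langle x,y\rangle : (x,y)\in R\}$ is in $\mathrm{P}$ (respectively $\mathrm{NP}$). For equivalence relations $R,S$ on $\Sigma^*$, say that $R$ polynomial-time kernel reduces to $S$ if there is a polynomial-time computable function $f\colon\Sigma^*\to\Sigma^*$ such that for all $x,y\in\Sigma^*$ we have $(x,y)\in R$ if and only if $(f(x),f(y))\in S$. An equivalence relation $S$ is $\mathrm{NPEq}$-complete if $S\in\mathrm{NPEq}$ and every $R\in\mathrm{NPEq}$ polynomial-time kernel reduces to $S$. Theorem. If $\mathrm{PEq}\neq\mathrm{NPEq}$, then there is an equivalence relation in $\mathrm{NPEq}$ that is neither in $\mathrm{PEq}$ nor $\mathrm{NPEq}$-complete. -/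

import Mathlib

namespace KernelReduction

open Turing

/-- Binary strings. -/
abbrev Str : Type := List Bool

/-- Every symbol of a string, written twice. -/
def double (x : Str) : Str := x.flatMap fun b => [b, b]

/-- The pairwise encoding `x₁x₁x₂x₂⋯01y₁y₁y₂y₂⋯` of two binary strings. -/
def pair (x y : Str) : Str := double x ++ [false, true] ++ double y

/-- The language induced by an equivalence relation on binary strings. -/
def langOf (R : Setoid Str) : Language Bool := {w | ∃ x y : Str, R x y ∧ w = pair x y}

/-- A nondeterministic Turing machine over the binary input alphabet. It consists of one of
Mathlib's finite multi-stack Turing machines, a second program `alt` for it (in every step the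
machine follows either `tm.m` or `alt`, at its choice) and a set of accepting internal states.
The output stack `tm.k₁` plays no special role. -/
structure NTM where
  /-- the underlying machine, with the first of the two programs -/
  tm : FinTM2
  /-- the second program -/
  alt : tm.Λ → TM2.Stmt tm.Γ tm.Λ tm.σ
  /-- the input alphabet is `{0, 1}` -/
  inputAlphabet : tm.Γ tm.k₀ ≃ Bool
  /-- the accepting internal states -/
  accept : Set tm.σ

namespace NTM

variable (N : NTM)

/-- The machine is deterministic if it never has a choice: its two programs are the same. -/
def Deterministic : Prop := N.alt = N.tm.m

/-- The initial configuration on input `w`. -/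
def init (w : Str) : N.tm.Cfg := initList N.tm (w.map N.inputAlphabet.symm)

/-- One step of the machine. There is no step from a configuration that has halted. -/
def Step (c c' : N.tm.Cfg) : Prop :=
  TM2.step N.tm.m c = some c' ∨ TM2.step N.alt c = some c'

/-- `N.Steps n c c'`: some computation path leads from `c` to `c'` in exactly `n` steps. -/
inductive Steps : ℕ → N.tm.Cfg → N.tm.Cfg → Prop
  | refl (c : N.tm.Cfg) : Steps 0 c c
  | tail {n : ℕ} {c c' c'' : N.tm.Cfg} : Steps n c c' → N.Step c' c'' → Steps (n + 1) c c''

/-- Some computation path on input `w` halts in an accepting state. -/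
def Accepts (w : Str) : Prop :=
  ∃ (n : ℕ) (c : N.tm.Cfg), N.Steps n (N.init w) c ∧ c.l = none ∧ c.var ∈ N.accept

/-- On input `w`, every computation path halts after at most `t` steps. -/
def HaltsWithin (w : Str) (t : ℕ) : Prop :=
  ∀ (n : ℕ) (c : N.tm.Cfg), N.Steps n (N.init w) c → n ≤ t

/-- The machine decides the language `L` in polynomial time. -/
def DecidesInPolyTime (L : Language Bool) : Prop :=
  (∃ p : Polynomial ℕ, ∀ w : Str, N.HaltsWithin w (p.eval w.length)) ∧
    ∀ w : Str, w ∈ L ↔ N.Accepts w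

end NTM

/-- The class **P**. -/
def classP : Set (Language Bool) := {L | ∃ M : NTM, M.Deterministic ∧ M.DecidesInPolyTime L}

/-- The class **NP**. -/
def classNP : Set (Language Bool) := {L | ∃ N : NTM, N.DecidesInPolyTime L}

/-- The class **FP** of polynomial-time computable functions on binary strings. -/
def classFP : Set (Str → Str) := {f | Nonempty (TM2ComputableInPolyTime id id f)}

/-- The equivalence relations whose induced language lies in the complexity class `C`. -/
def eqClass (C : Set (Language Bool)) : Set (Setoid Str) := {R | langOf R ∈ C}

/-- The class **PEq**. -/
def PEq : Set (Setoid Str) := eqClass classP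

/-- The class **NPEq**. -/
def NPEq : Set (Setoid Str) := eqClass classNP

/-- `R` polynomial-time kernel reduces to `S`. -/
def PolyKernelReduces (R S : Setoid Str) : Prop :=
  ∃ f ∈ classFP, ∀ x y : Str, R x y ↔ S (f x) (f y)

/-- `S` is hard, under polynomial-time kernel reductions, for the class `D` of equivalence
relations. -/
def IsHard (D : Set (Setoid Str)) (S : Setoid Str) : Prop :=
  ∀ R ∈ D, PolyKernelReduces R S

/-- `S` is complete, under polynomial-time kernel reductions, in the class `D` of equivalence
relations. -/
def IsComplete (D : Set (Setoid Str)) (S : Setoid Str) : Prop :=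
  S ∈ D ∧ IsHard D S

end KernelReduction

/-!
Let `L` be in NP but not in P. For a bit `b`, let `B b` be the set of strings the iterated
logarithm of whose length has parity `b`; it is in P. Since `(B 0 ∪ L) ∩ (B 1 ∪ L) = L`, one of the
two unions `C = B b ∪ L` is not in P. Let `R` be the equivalence relation that identifies all the
elements of `C` and no other strings. It is in NPEq, and not in PEq, as membership in `C` amounts to
equivalence with a fixed element of `C`.

Not even equality reduces to `R`. A reduction `f` would be injective, and map at most one string
into `C`. The iterated logarithm is constant on intervals from `m` to `2 ^ m` for arbitrarily large
`m` of either parity, and `f` grows polynomially. Hence for suitable `m` every string of length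
`m + 1` is mapped to one that is shorter than `m` or belongs to `C`, so that `2 ^ (m + 1)` strings
are mapped injectively to the fewer than `2 ^ m` shorter ones and a single other one.
-/

namespace KernelReduction

open Turing

/-! ### Nondeterministic computations -/

namespace NTM

/-- The first (`false`) or the second (`true`) program of a machine. -/
def prog (N : NTM) (b : Bool) : N.tm.Λ → TM2.Stmt N.tm.Γ N.tm.Λ N.tm.σ :=
  cond b N.alt N.tm.m

/-- Some computation path from `c` halts in an accepting state. -/
def AcceptsFrom (N : NTM) (c : N.tm.Cfg) : Prop :=
  ∃ (n : ℕ) (d : N.tm.Cfg), N.Steps n c d ∧ d.l = none ∧ d.var ∈ N.accept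

/-- `N.Decides t c p`: every computation path from `c` halts after at most `t` steps, and some path
halts in an accepting state if and only if `p` holds. Unlike the definition of acceptance, which
follows a path from its beginning, this describes the tree of all paths from `c`. -/
inductive Decides (N : NTM) : ℕ → N.tm.Cfg → Prop → Prop
  | halted (t : ℕ) (v : N.tm.σ) (S : ∀ k, List (N.tm.Γ k)) :
    Decides N t ⟨none, v, S⟩ (v ∈ N.accept)
  | step {t : ℕ} {l : N.tm.Λ} {v : N.tm.σ} {S : ∀ k, List (N.tm.Γ k)} {p : Bool → Prop}
    (h : ∀ b, Decides N t (TM2.stepAux (N.prog b l) v S) (p b)) :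
    Decides N (t + 1) ⟨some l, v, S⟩ (∃ b, p b)

variable {N : NTM}

theorem step_some_iff {l : N.tm.Λ} {v : N.tm.σ} {S : ∀ k, List (N.tm.Γ k)} {d : N.tm.Cfg} :
    N.Step ⟨some l, v, S⟩ d ↔ ∃ b, TM2.stepAux (N.prog b l) v S = d := by
  simp only [Step, prog, TM2.step.eq_2, Bool.exists_bool]
  exact or_congr Option.some_inj Option.some_inj

theorem not_step_none {v : N.tm.σ} {S : ∀ k, List (N.tm.Γ k)} {d : N.tm.Cfg} :
    ¬ N.Step ⟨none, v, S⟩ d := by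
  simp [Step]

theorem Steps.head {n : ℕ} {c c' d : N.tm.Cfg} (h : N.Step c c') (h' : N.Steps n c' d) :
    N.Steps (n + 1) c d := by
  induction h' with
  | refl => exact .tail (.refl _) h
  | tail _ hlast ih => exact .tail (ih h) hlast

theorem Steps.cases_head {n : ℕ} {c d : N.tm.Cfg} (h : N.Steps n c d) :
    (n = 0 ∧ c = d) ∨ ∃ m c', n = m + 1 ∧ N.Step c c' ∧ N.Steps m c' d := by
  induction h with
  | refl => exact .inl ⟨rfl, rfl⟩
  | tail _ hlast ih =>
    rcases ih with ⟨rfl, rfl⟩ | ⟨m, c', rfl, hfirst, hrest⟩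
    · exact .inr ⟨0, _, rfl, hlast, .refl _⟩
    · exact .inr ⟨m + 1, c', rfl, hfirst, .tail hrest hlast⟩

theorem acceptsFrom_none_iff {v : N.tm.σ} {S : ∀ k, List (N.tm.Γ k)} :
    N.AcceptsFrom ⟨none, v, S⟩ ↔ v ∈ N.accept := by
  constructor
  · rintro ⟨n, d, hn, -, hd⟩
    rcases hn.cases_head with ⟨-, rfl⟩ | ⟨_, _, -, hstep, -⟩
    · exact hd
    · exact absurd hstep not_step_none
  · exact fun h => ⟨0, _, .refl _, rfl, h⟩

theorem acceptsFrom_some_iff {l : N.tm.Λ} {v : N.tm.σ} {S : ∀ k, List (N.tm.Γ k)} :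
    N.AcceptsFrom ⟨some l, v, S⟩ ↔ ∃ b, N.AcceptsFrom (TM2.stepAux (N.prog b l) v S) := by
  constructor
  · rintro ⟨n, d, hn, hl, hd⟩
    rcases hn.cases_head with ⟨-, rfl⟩ | ⟨m, c, -, hstep, hm⟩
    · cases hl
    · obtain ⟨b, rfl⟩ := step_some_iff.1 hstep
      exact ⟨b, m, d, hm, hl, hd⟩
  · rintro ⟨b, n, d, hn, hd⟩
    exact ⟨n + 1, d, hn.head (step_some_iff.2 ⟨b, rfl⟩), hd⟩

namespace Decides

theorem congr {t : ℕ} {c : N.tm.Cfg} {p q : Prop} (h : N.Decides t c p) (hpq : p ↔ q) :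
    N.Decides t c q :=
  propext hpq ▸ h

theorem mono {s t : ℕ} {c : N.tm.Cfg} {p : Prop} (h : N.Decides s c p) (hst : s ≤ t) :
    N.Decides t c p := by
  induction h generalizing t with
  | halted => exact .halted ..
  | step _ ih =>
    obtain ⟨t, rfl⟩ := Nat.exists_eq_add_one_of_ne_zero (Nat.ne_zero_of_lt hst)
    exact .step fun b => ih b (Nat.le_of_succ_le_succ hst)

theorem of_stepAux {t : ℕ} {l : N.tm.Λ} {v : N.tm.σ} {S : ∀ k, List (N.tm.Γ k)} {p : Prop}
    (h : ∀ b, N.Decides t (TM2.stepAux (N.prog b l) v S) p) :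
    N.Decides (t + 1) ⟨some l, v, S⟩ p :=
  (step h).congr (exists_const Bool)

theorem length_le {t : ℕ} {c : N.tm.Cfg} {p : Prop} (h : N.Decides t c p) {n : ℕ} {d : N.tm.Cfg}
    (hn : N.Steps n c d) : n ≤ t := by
  induction h generalizing n d with
  | halted =>
    rcases hn.cases_head with ⟨rfl, -⟩ | ⟨_, _, -, hstep, -⟩
    · exact Nat.zero_le _
    · exact absurd hstep not_step_none
  | step _ ih =>
    rcases hn.cases_head with ⟨rfl, -⟩ | ⟨m, c, rfl, hstep, hm⟩
    · exact Nat.zero_le _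
    · obtain ⟨b, rfl⟩ := step_some_iff.1 hstep
      exact Nat.succ_le_succ (ih b hm)

theorem acceptsFrom_iff {t : ℕ} {c : N.tm.Cfg} {p : Prop} (h : N.Decides t c p) :
    N.AcceptsFrom c ↔ p := by
  induction h with
  | halted => exact acceptsFrom_none_iff
  | step _ ih => exact acceptsFrom_some_iff.trans (exists_congr ih)

theorem of_length_le {t : ℕ} {c : N.tm.Cfg} (h : ∀ n d, N.Steps n c d → n ≤ t) :
    N.Decides t c (N.AcceptsFrom c) := by
  induction t generalizing c with
  | zero =>
    obtain ⟨_ | l, v, S⟩ := c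
    · exact (halted ..).congr acceptsFrom_none_iff.symm
    · have := h 1 _ (.tail (.refl _) (step_some_iff.2 ⟨false, rfl⟩))
      omega
  | succ t ih =>
    obtain ⟨_ | l, v, S⟩ := c
    · exact (halted ..).congr acceptsFrom_none_iff.symm
    · refine (step fun b => ih fun n d hn => ?_).congr acceptsFrom_some_iff.symm
      exact Nat.le_of_succ_le_succ (h _ _ (hn.head (step_some_iff.2 ⟨b, rfl⟩)))

/-- `e` embeds the computations of `M` into those of `N`, where a halting configuration of `M`
becomes one from which `N` continues; `Φ` describes the outcome of that continuation. -/
theorem simulate {M : NTM} (e : M.tm.Cfg → N.tm.Cfg) {Φ : Prop → Prop} {s : ℕ}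
    (hΦ : ∀ p : Bool → Prop, (∃ b, Φ (p b)) ↔ Φ (∃ b, p b))
    (hstep : ∀ l v S, ∃ l' v' S', e ⟨some l, v, S⟩ = ⟨some l', v', S'⟩ ∧
      ∀ b, TM2.stepAux (N.prog b l') v' S' = e (TM2.stepAux (M.prog b l) v S))
    (hhalt : ∀ v S, N.Decides s (e ⟨none, v, S⟩) (Φ (v ∈ M.accept)))
    {t : ℕ} {c : M.tm.Cfg} {p : Prop} (h : M.Decides t c p) : N.Decides (t + s) (e c) (Φ p) := by
  induction h with
  | halted => exact (hhalt _ _).mono (Nat.le_add_left ..)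
  | @step t l v S p _ ih =>
    obtain ⟨l', v', S', he, hs⟩ := hstep l v S
    rw [he, Nat.add_right_comm]
    exact (step fun b => hs b ▸ ih b).congr (hΦ p)

end Decides

theorem haltsWithin_and_accepts_iff {w : Str} {t : ℕ} {p : Prop} :
    (N.HaltsWithin w t ∧ (p ↔ N.Accepts w)) ↔ N.Decides t (N.init w) p :=
  ⟨fun h => (Decides.of_length_le h.1).congr h.2.symm,
    fun h => ⟨fun _ _ => h.length_le, h.acceptsFrom_iff.symm⟩⟩

theorem decidesInPolyTime_iff {L : Language Bool} : N.DecidesInPolyTime L ↔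
    ∃ q : Polynomial ℕ, ∀ w : Str, N.Decides (q.eval w.length) (N.init w) (w ∈ L) := by
  simp only [← haltsWithin_and_accepts_iff, forall_and, exists_and_right, DecidesInPolyTime]

/-- The computation from `c` continues as the one from `d`, after at most `n` further steps. -/
def LeadsTo (N : NTM) (n : ℕ) (c d : N.tm.Cfg) : Prop :=
  ∀ ⦃t p⦄, N.Decides t d p → N.Decides (t + n) c p

namespace LeadsTo

theorem refl (c : N.tm.Cfg) : N.LeadsTo 0 c c := fun _ _ => id

theorem trans {m n : ℕ} {c c' d : N.tm.Cfg} (h : N.LeadsTo m c c') (h' : N.LeadsTo n c' d) :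
    N.LeadsTo (m + n) c d :=
  fun _ _ hd => (h (h' hd)).mono (by omega)

theorem mono {m n : ℕ} {c d : N.tm.Cfg} (h : N.LeadsTo m c d) (hmn : m ≤ n) :
    N.LeadsTo n c d :=
  fun _ _ hd => (h hd).mono (by omega)

end LeadsTo

theorem init_eq (w : Str) : N.init w = ⟨some N.tm.main, N.tm.initialState,
    Function.update (fun _ => []) N.tm.k₀ (w.map N.inputAlphabet.symm)⟩ := by
  unfold init initList
  congr 1
  funext k
  by_cases h : k = N.tm.k₀
  · subst h
    simp
  · simp [h]

end NTM

/-! ### Transducers -/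

/-- A finite transducer with two output tapes, whose run may fail. At the end of the input it
appends a last string to each output, according to its final state. -/
structure Transducer where
  /-- the states -/
  Q : Type
  /-- there are finitely many states -/
  [fintypeQ : Fintype Q]
  /-- the initial state -/
  start : Q
  /-- the next state -/
  next : Q → Bool → Q
  /-- the strings that a transition appends to the outputs -/
  out : Q → Bool → Fin 2 → Str
  /-- the strings that are appended to the outputs in the end; `none` in the rejecting states -/
  final : Q → Option (Fin 2 → Str)

namespace Transducer

attribute [instance] fintypeQ

/-- The outputs of the transducer when it is started in the state `q`. -/
def runFrom (T : Transducer) (q : T.Q) : Str → Option (Fin 2 → Str)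
  | [] => T.final q
  | b :: w => (T.runFrom (T.next q b) w).map fun x i => T.out q b i ++ x i

/-- The outputs of the transducer. -/
def run (T : Transducer) : Str → Option (Fin 2 → Str) := T.runFrom T.start

theorem runFrom_cons_cons {T : Transducer} {q : T.Q} {a b : Bool} {w : Str} {x y : Fin 2 → Str}
    (h : T.runFrom (T.next (T.next q a) b) w = some x)
    (hy : ∀ i, T.out q a i ++ (T.out (T.next q a) b i ++ x i) = y i) :
    T.runFrom q (a :: b :: w) = some y := by
  simp only [runFrom, h, Option.map_some, hy]

theorem exists_length_le (T : Transducer) :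
    ∃ B, ∀ w x, T.run w = some x → ∀ i, (x i).length ≤ B * (w.length + 1) := by
  obtain ⟨A, hA⟩ := (Set.finite_range fun z : T.Q × Bool × Fin 2 =>
    (T.out z.1 z.2.1 z.2.2).length).bddAbove
  obtain ⟨B, hB⟩ := (Set.finite_range fun z : T.Q × Fin 2 =>
    ((T.final z.1).elim [] (· z.2)).length).bddAbove
  suffices h : ∀ w q x, T.runFrom q w = some x → ∀ i, (x i).length ≤ A * w.length + B by
    refine ⟨A + B, fun w x hx i => (h w _ x hx i).trans ?_⟩
    linarith [Nat.zero_le A, Nat.zero_le (B * w.length)]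
  intro w
  induction w with
  | nil =>
    intro q x hx i
    have hle := hB (Set.mem_range_self (q, i))
    rw [runFrom] at hx
    simpa [hx] using hle
  | cons b w ih =>
    intro q x hx i
    obtain ⟨y, hy, rfl⟩ := Option.map_eq_some_iff.1 hx
    have hle : (T.out q b i).length ≤ A := hA (Set.mem_range_self (q, b, i))
    have := ih _ _ hy i
    rw [List.length_append, List.length_cons]
    linarith

/-- The transducer with a single state, which applies a monoid morphism to its input and then
appends a fixed string to each output. -/
def ofMorphism (h : Bool → Fin 2 → Str) (u : Fin 2 → Str) : Transducer where
  Q := Unit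
  start := ()
  next _ _ := ()
  out _ := h
  final _ := some u

theorem run_ofMorphism (h : Bool → Fin 2 → Str) (u : Fin 2 → Str) (w : Str) :
    (ofMorphism h u).run w = some fun i => w.flatMap (h · i) ++ u i := by
  induction w with
  | nil => rfl
  | cons b w ih =>
    refine (congrArg (Option.map _) ih).trans (congrArg some (funext fun i => ?_))
    rw [List.flatMap_cons, List.append_assoc]
    rfl

/-- The transducer with outputs `w` and `w` on input `w`. -/
def copy : Transducer := ofMorphism (fun b _ => [b]) fun _ => []

theorem run_copy (w : Str) : copy.run w = some fun _ => w := by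
  simp [copy, run_ofMorphism]

/-- The transducer with outputs `pair w z` and `pair w z` on input `w`. -/
def pairWith (z : Str) : Transducer :=
  ofMorphism (fun b _ => [b, b]) fun _ => [false, true] ++ double z

theorem run_pairWith (z w : Str) : (pairWith z).run w = some fun _ => pair w z := by
  simp [pairWith, run_ofMorphism, pair, double]

/-- The transducer whose outputs are the unary notation of the length of its input and the empty
string. -/
def tally : Transducer := ofMorphism (fun _ => ![[true], []]) fun _ => []

theorem run_tally (w : Str) : tally.run w = some ![List.replicate w.length true, []] := by
  rw [tally, run_ofMorphism, Option.some_inj]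
  funext i
  fin_cases i <;> simp [← List.map_eq_flatMap]

/-- The states of the transducer that inverts `pair`: it is about to read a doubled symbol of the
first or of the second component, or has read the first of two symbols, or has failed. -/
inductive UnpairState
  | first
  | firstHalf (a : Bool)
  | second
  | secondHalf (a : Bool)
  | failed
  deriving Fintype

/-- The transducer with outputs `x` and `y` on input `pair x y`, which fails on the other inputs. -/
def unpair : Transducer where
  Q := UnpairState
  start := .first
  next
    | .first, a => .firstHalf a
    | .firstHalf false, true => .second
    | .firstHalf a, b => if a = b then .first else .failed
    | .second, a => .secondHalf a
    | .secondHalf a, b => if a = b then .second else .failed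
    | .failed, _ => .failed
  out
    | .firstHalf a, b => ![if a = b then [a] else [], []]
    | .secondHalf a, _ => ![[], [a]]
    | _, _ => fun _ => []
  final
    | .second => some fun _ => []
    | _ => none

theorem runFrom_unpair_second (y : Str) :
    unpair.runFrom .second (double y) = some ![[], y] := by
  induction y with
  | nil => exact congrArg some (funext fun i => by fin_cases i <;> rfl)
  | cons a y ih =>
    cases a <;> exact runFrom_cons_cons ih fun i => by fin_cases i <;> rfl

theorem run_unpair_pair (x y : Str) : unpair.run (pair x y) = some ![x, y] := by
  induction x with
  | nil => exact runFrom_cons_cons (runFrom_unpair_second y) fun i => by fin_cases i <;> rfl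
  | cons a x ih =>
    cases a <;> exact runFrom_cons_cons ih fun i => by fin_cases i <;> rfl

theorem eq_pair_of_run_unpair {w : Str} {x : Fin 2 → Str} (h : unpair.run w = some x) :
    w = pair (x 0) (x 1) := by
  suffices key : ∀ (w : Str) q x, unpair.runFrom q w = some x → match q with
      | .first => w = pair (x 0) (x 1)
      | .firstHalf a => a :: w = pair (x 0) (x 1)
      | .second => x 0 = [] ∧ w = double (x 1)
      | .secondHalf a => x 0 = [] ∧ a :: w = double (x 1)
      | .failed => False from key w .first x h
  intro w
  induction w with
  | nil =>
    rintro (_ | _ | _ | _ | _) x hx <;> cases hx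
    exact ⟨rfl, rfl⟩
  | cons b w ih =>
    intro q x hx
    obtain ⟨y, hy, rfl⟩ := Option.map_eq_some_iff.1 hx
    have hy := ih _ _ hy
    rcases q with _ | a | _ | a | _
    · exact hy
    · cases a <;> cases b <;> simp_all [unpair, pair, double]
    · exact hy
    · cases a <;> cases b <;> simp_all [unpair, pair, double]
    · exact hy

theorem run_unpair_eq_some_iff {w : Str} {x : Fin 2 → Str} :
    unpair.run w = some x ↔ w = pair (x 0) (x 1) := by
  refine ⟨eq_pair_of_run_unpair, ?_⟩
  rintro rfl
  rw [run_unpair_pair]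
  congr 1
  funext i
  fin_cases i <;> rfl

end Transducer

/-! ### Machines that work on the output of a transducer -/

/-- The stacks of the machine that consists of a transducer and a program with stacks `K`:
`bits none` holds the input, and the transducer fills `bits (some 0)` and `bits (some 1)`. -/
inductive Stack (K : Type)
  | bits (j : Option (Fin 2))
  | inner (k : K)
  deriving DecidableEq, Fintype

/-- The labels of the machine that consists of a transducer with states `Q` and a program with
labels `Λ`. -/
inductive Label (Q Λ : Type)
  | read (q : Q)
  | body (l : Λ)
  deriving Fintype

section Program

variable {K Q Λ σ : Type} {Γ : K → Type}

/-- The stack alphabets, where `Γ` are those of the program's own stacks. -/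
abbrev Alphabet (Γ : K → Type) : Stack K → Type
  | .bits _ => Bool
  | .inner k => Γ k

/-- The contents of the stacks: `w` is what is left of the input, and `x` are the buffers. -/
def contents (w : Str) (x : Fin 2 → Str) (S : ∀ k, List (Γ k)) : ∀ k, List (Alphabet Γ k)
  | .bits j => j.elim w x
  | .inner k => S k

/-- The statements of the machine. Its state has a component for the program, and a register which
holds the popped symbol during a case distinction and the verdict in the end. -/
abbrev Statement (Γ : K → Type) (Q Λ σ : Type) : Type :=
  TM2.Stmt (Alphabet Γ) (Label Q Λ) (σ × Option Bool)

/-- The configurations of the machine. -/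
abbrev Config (Γ : K → Type) (Q Λ σ : Type) : Type :=
  TM2.Cfg (Alphabet Γ) (Label Q Λ) (σ × Option Bool)

variable [DecidableEq K]

@[simp]
theorem update_contents_input (w : Str) (x : Fin 2 → Str) (S : ∀ k, List (Γ k)) (u : Str) :
    Function.update (contents w x S) (.bits none) u = contents u x S := by
  funext k
  rcases k with (_ | i) | k <;> simp [contents]

@[simp]
theorem update_contents_buffer (w : Str) (x : Fin 2 → Str) (S : ∀ k, List (Γ k)) (i : Fin 2)
    (u : Str) :
    Function.update (contents w x S) (.bits (some i)) u = contents w (Function.update x i u) S := by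
  funext k
  rcases k with (_ | j) | k
  · simp [contents]
  · rcases eq_or_ne j i with rfl | h
    · simp [contents]
    · simp [contents, h]
  · simp [contents]

@[simp]
theorem update_contents_inner (w : Str) (x : Fin 2 → Str) (S : ∀ k, List (Γ k)) (k : K)
    (u : List (Γ k)) :
    Function.update (contents w x S) (.inner k) u = contents w x (Function.update S k u) := by
  funext k'
  rcases k' with j | k'
  · rfl
  · rcases eq_or_ne k' k with rfl | h
    · simp [contents]
    · simp [contents, h]

namespace Statement

/-- Pop a bit and continue according to it; `none` stands for the empty stack. -/
def popCase (j : Option (Fin 2)) (f : Option Bool → Statement Γ Q Λ σ) : Statement Γ Q Λ σ :=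
  .pop (.bits j) (fun s a => (s.1, a)) <|
    .branch (fun s => s.2.isNone) (f none) <|
      .branch (fun s => s.2 = some true) (.load (fun s => (s.1, none)) (f (some true)))
        (.load (fun s => (s.1, none)) (f (some false)))

theorem stepAux_popCase (j : Option (Fin 2)) (f : Option Bool → Statement Γ Q Λ σ)
    (s : σ × Option Bool) (S : ∀ k, List (Alphabet Γ k)) :
    TM2.stepAux (popCase j f) s S = TM2.stepAux (f (S (.bits j)).head?) (s.1, none)
      (Function.update S (.bits j) (S (.bits j)).tail) := by
  rcases h : S (.bits j) with _ | ⟨_ | _, u⟩ <;> simp [popCase, h]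

/-- Append a string to each buffer; the buffers are read from the top of the stack backwards. -/
def emit (u : Fin 2 → Str) (q : Statement Γ Q Λ σ) : Statement Γ Q Λ σ :=
  (u 0).foldr (fun b => .push (.bits (some 0)) fun _ => b) <|
    (u 1).foldr (fun b => .push (.bits (some 1)) fun _ => b) q

theorem stepAux_foldr_push (j : Option (Fin 2)) (u : Str) (q : Statement Γ Q Λ σ)
    (s : σ × Option Bool) (S : ∀ k, List (Alphabet Γ k)) :
    TM2.stepAux (u.foldr (fun b => .push (.bits j) fun _ => b) q) s S =
      TM2.stepAux q s (Function.update S (.bits j) (u.reverse ++ S (.bits j))) := by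
  induction u generalizing S with
  | nil => simp
  | cons b u ih => simp [ih]

theorem stepAux_emit (u : Fin 2 → Str) (q : Statement Γ Q Λ σ) (s : σ × Option Bool) (w : Str)
    (x : Fin 2 → Str) (S : ∀ k, List (Γ k)) :
    TM2.stepAux (emit u q) s (contents w x S) =
      TM2.stepAux q s (contents w (fun i => (u i).reverse ++ x i) S) := by
  simp only [emit, stepAux_foldr_push, update_contents_buffer]
  congr 2
  funext i
  fin_cases i <;> simp [contents]

/-- Halt with the given verdict. -/
def verdict (b : Bool) : Statement Γ Q Λ σ :=
  .load (fun s => (s.1, some b)) .halt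

/-- Continue at a label of the program. -/
abbrev call (l : Λ) : Statement Γ Q Λ σ := .goto fun _ => .body l

end Statement

end Program

namespace Transducer

open Statement

variable {K Λ σ : Type} {Γ : K → Type} [DecidableEq K]

/-- A step of the transducer `T` in the state `q`; at the end of the input, the program is started
at `main`. -/
def readStatement (T : Transducer) (main : Λ) (q : T.Q) : Statement Γ T.Q Λ σ :=
  popCase none fun
    | some b => emit (T.out q b) (.goto fun _ => .read (T.next q b))
    | none => (T.final q).elim (verdict false) fun u => emit u (call main)

theorem stepAux_readStatement_cons (T : Transducer) (main : Λ) (q : T.Q) (a : Bool) (w : Str)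
    (s : σ) (x : Fin 2 → Str) (S : ∀ k, List (Γ k)) :
    TM2.stepAux (T.readStatement main q) (s, none) (contents (a :: w) x S) =
      ⟨some (.read (T.next q a)), (s, none),
        contents w (fun i => (T.out q a i).reverse ++ x i) S⟩ := by
  rw [readStatement, stepAux_popCase, update_contents_input]
  exact stepAux_emit ..

theorem stepAux_readStatement_nil_of_some {T : Transducer} {q : T.Q} {u : Fin 2 → Str}
    (h : T.final q = some u) (main : Λ) (s : σ) (x : Fin 2 → Str) (S : ∀ k, List (Γ k)) :
    TM2.stepAux (T.readStatement main q) (s, none) (contents [] x S) =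
      ⟨some (.body main), (s, none), contents [] (fun i => (u i).reverse ++ x i) S⟩ := by
  rw [readStatement, stepAux_popCase, update_contents_input]
  simpa [contents, h] using stepAux_emit u (call main) (s, none) [] x S

theorem stepAux_readStatement_nil_of_none {T : Transducer} {q : T.Q}
    (h : T.final q = none) (main : Λ) (s : σ) (x : Fin 2 → Str) (S : ∀ k, List (Γ k)) :
    TM2.stepAux (T.readStatement main q) (s, none) (contents [] x S) =
      ⟨none, (s, some false), contents [] x S⟩ := by
  rw [readStatement, stepAux_popCase, update_contents_input]
  simp [contents, h, verdict]

/-- One of the two programs of the machine that runs `T` and then `body`. -/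
def program (T : Transducer) (main : Λ) (body : Bool → Λ → Statement Γ T.Q Λ σ) (b : Bool) :
    Label T.Q Λ → Statement Γ T.Q Λ σ
  | .read q => T.readStatement main q
  | .body l => body b l

variable [Fintype K] [Fintype Λ] [Fintype σ]

/-- The machine that runs the transducer `T` on its input and then the nondeterministic program
`body` on the outputs; it rejects if `T` fails. -/
def machine (T : Transducer) (main : Λ) (s₀ : σ) (body : Bool → Λ → Statement Γ T.Q Λ σ) : NTM where
  tm :=
    { K := Stack K
      k₀ := .bits none
      k₁ := .bits none
      Γ := Alphabet Γ
      Λ := Label T.Q Λ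
      main := .read T.start
      σ := σ × Option Bool
      initialState := (s₀, none)
      Γk₀Fin := inferInstanceAs (Fintype Bool)
      m := T.program main body false }
  alt := T.program main body true
  inputAlphabet := .refl Bool
  accept := {s | s.2 = some true}

variable {T : Transducer} {main : Λ} {s₀ : σ} {body : Bool → Λ → Statement Γ T.Q Λ σ}

theorem decides_step {t : ℕ} {l : Label T.Q Λ} {s : σ × Option Bool}
    {S : ∀ k, List (Alphabet Γ k)} {c : Config Γ T.Q Λ σ} {p : Prop}
    (h : ∀ b, TM2.stepAux (T.program main body b l) s S = c)
    (hc : (T.machine main s₀ body).Decides t c p) :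
    (T.machine main s₀ body).Decides (t + 1) ⟨some l, s, S⟩ p :=
  .of_stepAux fun b => by cases b <;> exact h _ ▸ hc

theorem leadsTo_step {n : ℕ} {l : Label T.Q Λ} {s : σ × Option Bool}
    {S : ∀ k, List (Alphabet Γ k)} {c : Config Γ T.Q Λ σ} {d : (T.machine main s₀ body).tm.Cfg}
    (h : ∀ b, TM2.stepAux (T.program main body b l) s S = c)
    (h' : (T.machine main s₀ body).LeadsTo n c d) :
    (T.machine main s₀ body).LeadsTo (n + 1) ⟨some l, s, S⟩ d :=
  fun _ _ hd => decides_step h (h' hd)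

theorem decides_verdict (s : σ) (b : Bool) (S : ∀ k, List (Alphabet Γ k)) :
    (T.machine main s₀ body).Decides 0 ⟨none, (s, some b), S⟩ (b = true) :=
  (NTM.Decides.halted 0 (N := T.machine main s₀ body) (s, some b) S).congr Option.some_inj

theorem leadsTo_read {w : Str} {q : T.Q} {x : Fin 2 → Str} (h : T.runFrom q w = some x)
    (s : σ) (y : Fin 2 → Str) (S : ∀ k, List (Γ k)) :
    (T.machine main s₀ body).LeadsTo (w.length + 1) ⟨some (.read q), (s, none), contents w y S⟩
      ⟨some (.body main), (s, none), contents [] (fun i => (x i).reverse ++ y i) S⟩ := by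
  induction w generalizing q x y with
  | nil => exact leadsTo_step (fun _ => stepAux_readStatement_nil_of_some h ..) (.refl _)
  | cons a w ih =>
    obtain ⟨x, hx, rfl⟩ := Option.map_eq_some_iff.1 h
    refine leadsTo_step (fun _ => stepAux_readStatement_cons ..) ?_
    simp only [List.reverse_append, List.append_assoc]
    exact ih hx _

theorem decides_read_of_run_eq_none {w : Str} {q : T.Q} (h : T.runFrom q w = none)
    (s : σ) (y : Fin 2 → Str) (S : ∀ k, List (Γ k)) :
    (T.machine main s₀ body).Decides (w.length + 1)
      ⟨some (.read q), (s, none), contents w y S⟩ False := by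
  induction w generalizing q y with
  | nil =>
    exact .congr (decides_step (fun _ => stepAux_readStatement_nil_of_none h ..)
      (decides_verdict s false _)) (iff_of_false Bool.false_ne_true id)
  | cons a w ih =>
    exact decides_step (l := .read q) (fun _ => stepAux_readStatement_cons ..)
      (ih (Option.map_eq_none_iff.1 h) _)

theorem init_machine (w : Str) : (T.machine main s₀ body).init w =
    ⟨some (.read T.start), (s₀, none), contents w (fun _ => []) fun _ => []⟩ := by
  rw [NTM.init_eq]
  refine congrArg (TM2.Cfg.mk (some (Label.read T.start)) (s₀, none)) (funext fun k => ?_)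
  rcases k with (_ | _) | _
  · exact (Function.update_self ..).trans (List.map_id w)
  · rfl
  · rfl

theorem deterministic_machine (h : body true = body false) :
    (T.machine main s₀ body).Deterministic :=
  congrArg (fun f => T.program main (fun _ => f) true) h

theorem machine_decidesInPolyTime {p : (Fin 2 → Str) → Prop} (q : Polynomial ℕ)
    (h : ∀ w x, T.run w = some x → (T.machine main s₀ body).Decides (q.eval w.length)
      ⟨some (.body main), (s₀, none), contents [] (fun i => (x i).reverse) fun _ => []⟩ (p x)) :
    (T.machine main s₀ body).DecidesInPolyTime {w | ∃ x, T.run w = some x ∧ p x} := by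
  refine NTM.decidesInPolyTime_iff.2 ⟨q + .X + 1, fun w => ?_⟩
  have ht : (q + .X + 1).eval w.length = q.eval w.length + (w.length + 1) := by
    simp [add_assoc]
  rw [ht, init_machine]
  rcases hrun : T.run w with _ | x
  · refine ((decides_read_of_run_eq_none hrun ..).mono (by omega)).congr ?_
    exact iff_of_false id fun ⟨x, hx, _⟩ => nomatch hrun.symm.trans hx
  · have hread := leadsTo_read (main := main) (s₀ := s₀) (body := body) hrun s₀ (fun _ => [])
      fun _ => []
    simp only [List.append_nil] at hread
    refine (hread (h w x hrun)).congr ⟨fun hp => ⟨x, hrun, hp⟩, fun ⟨y, hy, hp⟩ => ?_⟩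
    rwa [Option.some.inj (hrun.symm.trans hy)]

end Transducer

@[simp]
theorem update_fin_two_zero {α : Type*} (a b c : α) : Function.update ![a, b] 0 c = ![c, b] := by
  ext i
  fin_cases i <;> rfl

@[simp]
theorem update_fin_two_one {α : Type*} (a b c : α) : Function.update ![a, b] 1 c = ![a, c] := by
  ext i
  fin_cases i <;> rfl

namespace Transducer

open Statement

section Equality

variable {T : Transducer}

/-- Pop a symbol from each buffer and compare them, until a buffer is empty or they differ. -/
def compareStatement : Statement Empty.elim T.Q Unit Unit :=
  popCase (some 0) fun
    | none => popCase (some 1) fun b => verdict b.isNone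
    | some a => popCase (some 1) fun b => if b = some a then call () else verdict false

/-- The machine that decides whether the two outputs of a transducer are equal. -/
def equalityMachine (T : Transducer) : NTM := T.machine () () fun _ _ => compareStatement

theorem stepAux_compareStatement_nil (v : Str) (S : ∀ k : Empty, List k.elim) :
    TM2.stepAux (compareStatement (T := T)) ((), none) (contents [] ![[], v] S) =
      ⟨none, ((), some v.head?.isNone), contents [] ![[], v.tail] S⟩ := by
  simp [compareStatement, stepAux_popCase, contents, verdict]

theorem stepAux_compareStatement_cons (a : Bool) (u v : Str) (S : ∀ k : Empty, List k.elim) :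
    TM2.stepAux (compareStatement (T := T)) ((), none) (contents [] ![a :: u, v] S) =
      if v.head? = some a then ⟨some (.body ()), ((), none), contents [] ![u, v.tail] S⟩
      else ⟨none, ((), some false), contents [] ![u, v.tail] S⟩ := by
  by_cases h : v.head? = some a <;>
    simp [compareStatement, stepAux_popCase, contents, verdict, h]

theorem decides_compare (u v : Str) (S : ∀ k : Empty, List k.elim) :
    T.equalityMachine.Decides (u.length + 1)
      ⟨some (.body ()), ((), none), contents [] ![u, v] S⟩ (u = v) := by
  induction u generalizing v with
  | nil =>
    refine .congr (decides_step (fun _ => stepAux_compareStatement_nil ..)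
      (decides_verdict ..)) ?_
    rw [Option.isNone_iff_eq_none, List.head?_eq_none_iff, eq_comm]
  | cons a u ih =>
    refine .congr (decides_step (p := v.head? = some a ∧ u = v.tail)
      (fun _ => stepAux_compareStatement_cons ..) ?_) ?_
    · split_ifs with h
      · exact (ih v.tail).congr (by simp [h])
      · exact ((decides_verdict ..).mono (Nat.zero_le _)).congr (by simp [h])
    · rcases v with _ | ⟨b, v⟩ <;> simp [eq_comm]

theorem setOf_run_eq_mem_classP (T : Transducer) :
    ({w | ∃ x, T.run w = some x ∧ x 0 = x 1} : Language Bool) ∈ classP := by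
  obtain ⟨B, hB⟩ := T.exists_length_le
  refine ⟨T.equalityMachine, deterministic_machine rfl,
    machine_decidesInPolyTime (.C B * (.X + 1) + 1) fun w x hx => ?_⟩
  have hx0 := hB w x hx 0
  have hrev : (fun i => (x i).reverse) = ![(x 0).reverse, (x 1).reverse] := by
    funext i
    fin_cases i <;> rfl
  rw [hrev]
  exact ((decides_compare ..).mono (by simpa using hx0)).congr List.reverse_inj

end Equality

/-! ### Combining two machines -/

section Combination

/-- The conjunction (`false`) or the disjunction (`true`) of two propositions. -/
def junction (d : Bool) (p q : Prop) : Prop := cond d (p ∨ q) (p ∧ q)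

theorem exists_junction_iff (d : Bool) {p : Bool → Prop} {q : Prop} :
    (∃ b, junction d (p b) q) ↔ junction d (∃ b, p b) q := by
  cases d
  · exact exists_and_right
  · exact exists_or.trans (or_congr_right (exists_const Bool))

theorem junction_iff_left {d : Bool} {p q : Prop} [Decidable p] (h : decide p = d) :
    junction d p q ↔ p := by
  subst h
  by_cases hp : p <;> simp [junction, hp]

theorem junction_iff_right {d : Bool} {p q : Prop} [Decidable p] (h : decide p ≠ d) :
    junction d p q ↔ q := by
  cases d <;> simp_all [junction]

/-- The labels of the machine that combines two machines: load the `i`-th buffer into the input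
stack of the `i`-th machine, run that machine, and evaluate its result. -/
inductive CombinedLabel (M : Fin 2 → NTM)
  | load (i : Fin 2)
  | run (i : Fin 2) (l : (M i).tm.Λ)
  | exit (i : Fin 2)

variable (M : Fin 2 → NTM)

/-- The stack alphabets of the two machines. -/
abbrev CombinedAlphabet (k : Σ i, (M i).tm.K) : Type := (M k.1).tm.Γ k.2

/-- The internal states of the two machines. -/
abbrev CombinedState : Type := ∀ i, (M i).tm.σ

noncomputable instance : Fintype (Σ i, (M i).tm.K) :=
  have (i : Fin 2) : Fintype (M i).tm.K := (M i).tm.kFin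
  inferInstance

noncomputable instance : Fintype (CombinedState M) :=
  have (i : Fin 2) : Fintype (M i).tm.σ := (M i).tm.σFin
  inferInstance

noncomputable instance : Fintype (CombinedLabel M) :=
  have (i : Fin 2) : Fintype (M i).tm.Λ := (M i).tm.ΛFin
  .ofInjective (β := (Fin 2 ⊕ Σ i, (M i).tm.Λ) ⊕ Fin 2) (fun
    | .load i => .inl (.inl i)
    | .run i l => .inl (.inr ⟨i, l⟩)
    | .exit i => .inr i) <| by
    rintro (_ | _ | _) (_ | _ | _) h <;> cases h <;> rfl

variable {M} {Q : Type}

/-- A statement of the `i`-th machine, as one of the combination. -/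
def lift (i : Fin 2) : TM2.Stmt (M i).tm.Γ (M i).tm.Λ (M i).tm.σ →
    Statement (CombinedAlphabet M) Q (CombinedLabel M) (CombinedState M)
  | .push k f q => .push (.inner ⟨i, k⟩) (fun s => f (s.1 i)) (lift i q)
  | .peek k f q =>
    .peek (.inner ⟨i, k⟩) (fun s a => (Function.update s.1 i (f (s.1 i) a), s.2)) (lift i q)
  | .pop k f q =>
    .pop (.inner ⟨i, k⟩) (fun s a => (Function.update s.1 i (f (s.1 i) a), s.2)) (lift i q)
  | .load f q => .load (fun s => (Function.update s.1 i (f (s.1 i)), s.2)) (lift i q)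
  | .branch f q₁ q₂ => .branch (fun s => f (s.1 i)) (lift i q₁) (lift i q₂)
  | .goto f => .goto fun s => .body (.run i (f (s.1 i)))
  | .halt => .goto fun _ => .body (.exit i)

/-- A configuration of the `i`-th machine, as one of the combination; `s` and `S` provide the state
and the stacks of the other machine. -/
def embed (i : Fin 2) (x : Fin 2 → Str) (s : CombinedState M)
    (S : ∀ i k, List ((M i).tm.Γ k)) (c : (M i).tm.Cfg) :
    Config (CombinedAlphabet M) Q (CombinedLabel M) (CombinedState M) :=
  ⟨some (.body (c.l.elim (.exit i) (.run i))), (Function.update s i c.var, none),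
    contents [] x (Sigma.uncurry (Function.update S i c.stk))⟩

theorem update_uncurry_update (i : Fin 2) (S : ∀ i k, List ((M i).tm.Γ k))
    (S' : ∀ k, List ((M i).tm.Γ k)) (k : (M i).tm.K) (u : List ((M i).tm.Γ k)) :
    Function.update (Sigma.uncurry (Function.update S i S')) ⟨i, k⟩ u =
      (Sigma.uncurry (Function.update S i (Function.update S' k u)) :
        ∀ k, List (CombinedAlphabet M k)) := by
  funext ⟨j, k'⟩
  rcases eq_or_ne j i with rfl | hj
  · rcases eq_or_ne k' k with rfl | hk
    · simp [Sigma.uncurry]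
    · simp [Sigma.uncurry, hk]
  · simp [Sigma.uncurry, hj]

theorem contents_uncurry_update (x : Fin 2 → Str) (i : Fin 2) (S : ∀ i k, List ((M i).tm.Γ k))
    (S' : ∀ k, List ((M i).tm.Γ k)) (k : (M i).tm.K) :
    contents [] x (Sigma.uncurry (Function.update S i S') : ∀ k, List (CombinedAlphabet M k))
      (.inner ⟨i, k⟩) = S' k :=
  congrFun (Function.update_self ..) k

theorem stepAux_lift (i : Fin 2) (x : Fin 2 → Str) (s : CombinedState M)
    (S : ∀ i k, List ((M i).tm.Γ k)) (q : TM2.Stmt (M i).tm.Γ (M i).tm.Λ (M i).tm.σ)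
    (v : (M i).tm.σ) (S' : ∀ k, List ((M i).tm.Γ k)) :
    TM2.stepAux (lift (Q := Q) i q) (Function.update s i v, none)
        (contents [] x (Sigma.uncurry (Function.update S i S'))) =
      embed i x s S (TM2.stepAux q v S') := by
  induction q generalizing v S' with
  | push k f q ih => simp [lift, ih, update_uncurry_update, contents_uncurry_update]
  | peek k f q ih => simp [lift, ih, contents_uncurry_update]
  | pop k f q ih => simp [lift, ih, update_uncurry_update, contents_uncurry_update]
  | load f q ih => simp [lift, ih]
  | branch f q₁ q₂ ih₁ ih₂ => cases h : f v <;> simp [lift, ih₁, ih₂, h]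
  | goto f => simp [lift, embed]
  | halt => simp [lift, embed]

/-- What happens when the `i`-th machine halts with verdict `b`: the second machine is started,
unless the value of the junction is settled. -/
def settle (d : Bool) (i : Fin 2) (b : Bool) :
    Statement (CombinedAlphabet M) Q (CombinedLabel M) (CombinedState M) :=
  if i = 1 ∨ b = d then verdict b else call (.load 1)

open Classical in
/-- The program that runs the two machines in turn, each on its own buffer. -/
noncomputable def combinedProgram (M : Fin 2 → NTM) (d b : Bool) :
    CombinedLabel M → Statement (CombinedAlphabet M) Q (CombinedLabel M) (CombinedState M)
  | .load i =>
    popCase (some i) fun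
      | some a =>
        .push (.inner ⟨i, (M i).tm.k₀⟩) (fun _ => (M i).inputAlphabet.symm a) (call (.load i))
      | none => call (.run i (M i).tm.main)
  | .run i l => lift i ((M i).prog b l)
  | .exit i =>
    .branch (fun s => s.1 i ∈ (M i).accept) (settle d i true) (settle d i false)

/-- The machine that evaluates the junction of the verdicts of two machines on the two outputs of a
transducer. -/
noncomputable def combinedMachine (T : Transducer) (M : Fin 2 → NTM) (d : Bool) : NTM :=
  T.machine (.load 0) (fun i => (M i).tm.initialState) (combinedProgram M d)

variable {T : Transducer} {d : Bool}

/-- The configuration in which the `i`-th machine is being loaded: `v` is on its input stack, and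
the `i`-th buffer still holds `u`. -/
def loading (i : Fin 2) (x : Fin 2 → Str) (s : CombinedState M) (S : ∀ i k, List ((M i).tm.Γ k))
    (u v : Str) : Config (CombinedAlphabet M) Q (CombinedLabel M) (CombinedState M) :=
  ⟨some (.body (.load i)), (Function.update s i (M i).tm.initialState, none),
    contents [] (Function.update x i u) (Sigma.uncurry (Function.update S i
      (Function.update (fun _ => []) (M i).tm.k₀ (v.map (M i).inputAlphabet.symm))))⟩

theorem stepAux_load_nil (b : Bool) (i : Fin 2) (x : Fin 2 → Str) (s : CombinedState M)
    (S : ∀ i k, List ((M i).tm.Γ k)) (v : Str) :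
    TM2.stepAux (combinedProgram (Q := Q) M d b (.load i))
        (Function.update s i (M i).tm.initialState, none)
        (contents [] (Function.update x i []) (Sigma.uncurry (Function.update S i
          (Function.update (fun _ => []) (M i).tm.k₀ (v.map (M i).inputAlphabet.symm))))) =
      embed i (Function.update x i []) s S ((M i).init v) := by
  rw [NTM.init_eq]
  simp [combinedProgram, stepAux_popCase, contents, embed]

theorem stepAux_load_cons (b : Bool) (i : Fin 2) (x : Fin 2 → Str) (s : CombinedState M)
    (S : ∀ i k, List ((M i).tm.Γ k)) (a : Bool) (u v : Str) :
    TM2.stepAux (combinedProgram (Q := Q) M d b (.load i))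
        (Function.update s i (M i).tm.initialState, none)
        (contents [] (Function.update x i (a :: u)) (Sigma.uncurry (Function.update S i
          (Function.update (fun _ => []) (M i).tm.k₀ (v.map (M i).inputAlphabet.symm))))) =
      loading i x s S u (a :: v) := by
  have hbuffer (k) : contents [] (Function.update x i (a :: u)) (Sigma.uncurry (Function.update S i
      (Function.update (fun _ => []) (M i).tm.k₀ (v.map (M i).inputAlphabet.symm))) :
        ∀ k, List (CombinedAlphabet M k)) (.bits (some k)) = Function.update x i (a :: u) k := rfl
  simp [combinedProgram, stepAux_popCase, loading, hbuffer, update_uncurry_update,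
    contents_uncurry_update]

theorem leadsTo_load (i : Fin 2) (x : Fin 2 → Str) (s : CombinedState M)
    (S : ∀ i k, List ((M i).tm.Γ k)) (u v : Str) :
    (T.combinedMachine M d).LeadsTo (u.length + 1) (loading i x s S u v)
      (embed i (Function.update x i []) s S ((M i).init (u.reverse ++ v))) := by
  induction u generalizing v with
  | nil => exact leadsTo_step (fun b => stepAux_load_nil (d := d) b ..) (.refl _)
  | cons a u ih =>
    rw [List.reverse_cons, List.append_assoc]
    exact leadsTo_step (fun b => stepAux_load_cons (d := d) b ..) (ih (a :: v))

theorem decides_load {i : Fin 2} {x : Fin 2 → Str} {s : CombinedState M}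
    {S : ∀ i k, List ((M i).tm.Γ k)} {u : Str} {t r : ℕ} {p : Prop} {Φ : Prop → Prop}
    (hΦ : ∀ p : Bool → Prop, (∃ b, Φ (p b)) ↔ Φ (∃ b, p b))
    (h : (M i).Decides t ((M i).init u.reverse) p)
    (hexit : ∀ v S', (T.combinedMachine M d).Decides r
      (embed i (Function.update x i []) s S ⟨none, v, S'⟩) (Φ (v ∈ (M i).accept))) :
    (T.combinedMachine M d).Decides (t + r + (u.length + 1)) (loading i x s S u []) (Φ p) := by
  have hsim : (T.combinedMachine M d).Decides (t + r)
      (embed i (Function.update x i []) s S ((M i).init u.reverse)) (Φ p) :=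
    h.simulate (N := T.combinedMachine M d) (embed i _ s S) hΦ
      (fun l v S' => ⟨_, _, _, rfl, fun b => by cases b <;> exact stepAux_lift ..⟩) hexit
  have hload := leadsTo_load (T := T) (d := d) i x s S u []
  rw [List.append_nil] at hload
  exact hload hsim

open Classical in
theorem stepAux_exit (b : Bool) (i : Fin 2) (s : CombinedState M)
    (S : ∀ k, List (Alphabet (CombinedAlphabet M) k)) :
    TM2.stepAux (combinedProgram (Q := Q) M d b (.exit i)) (s, none) S =
      if i = 1 ∨ (decide (s i ∈ (M i).accept) = d) then
        ⟨none, (s, some (s i ∈ (M i).accept)), S⟩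
      else ⟨some (.body (.load 1)), (s, none), S⟩ := by
  by_cases h : s i ∈ (M i).accept <;>
    simp only [combinedProgram, TM2.stepAux, h, decide_true, decide_false, cond, settle] <;>
    split_ifs <;> rfl

theorem loading_eq {i : Fin 2} {s : CombinedState M} {S : ∀ i k, List ((M i).tm.Γ k)}
    (hs : s i = (M i).tm.initialState) (hS : S i = fun _ => []) (x : Fin 2 → Str) :
    (loading i x s S (x i) [] : Config (CombinedAlphabet M) Q _ _) =
      ⟨some (.body (.load i)), (s, none), contents [] x (Sigma.uncurry S)⟩ := by
  rw [loading, ← hs, List.map_nil, Function.update_eq_self, Function.update_eq_self,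
    Function.update_eq_self_iff.2 rfl, ← hS, Function.update_eq_self]

theorem decides_exit_one (x : Fin 2 → Str) (s : CombinedState M)
    (S : ∀ i k, List ((M i).tm.Γ k)) (v : (M 1).tm.σ) (S' : ∀ k, List ((M 1).tm.Γ k)) :
    (T.combinedMachine M d).Decides 1 (embed 1 x s S ⟨none, v, S'⟩) (v ∈ (M 1).accept) := by
  classical
  have hexit (b : Bool) := (stepAux_exit (Q := T.Q) (d := d) b 1 (Function.update s 1 v)
    (contents [] x (Sigma.uncurry (Function.update S 1 S')))).trans (if_pos (.inl rfl))
  rw [Function.update_self] at hexit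
  exact .congr (decides_step hexit (decides_verdict ..)) decide_eq_true_iff

theorem decides_exit_zero {x : Fin 2 → Str} {s : CombinedState M}
    {S : ∀ i k, List ((M i).tm.Γ k)} {t : ℕ} {p : Prop}
    (hs : s 1 = (M 1).tm.initialState) (hS : S 1 = fun _ => [])
    (h : ∀ s S, (T.combinedMachine M d).Decides t (loading 1 x s S (x 1) []) p)
    (v : (M 0).tm.σ) (S' : ∀ k, List ((M 0).tm.Γ k)) :
    (T.combinedMachine M d).Decides (t + 1) (embed 0 x s S ⟨none, v, S'⟩)
      (junction d (v ∈ (M 0).accept) p) := by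
  classical
  have hexit (b : Bool) := stepAux_exit (Q := T.Q) (d := d) b 0 (Function.update s 0 v)
    (contents [] x (Sigma.uncurry (Function.update S 0 S')))
  rw [Function.update_self] at hexit
  by_cases hd : decide (v ∈ (M 0).accept) = d
  · simp only [hd, or_true, if_true] at hexit
    refine .congr (.mono (decides_step hexit (decides_verdict ..)) (by omega)) ?_
    rw [← hd, decide_eq_true_iff, junction_iff_left rfl]
  · simp only [hd, or_false, zero_ne_one, if_false] at hexit
    rw [← loading_eq (by simpa using hs) (by simpa using hS)] at hexit
    exact .congr (decides_step hexit (h ..)) (junction_iff_right hd).symm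

theorem monotone_eval (q : Polynomial ℕ) : Monotone (q.eval ·) := by
  induction q using Polynomial.induction_on' with
  | add p q hp hq => simpa using hp.add hq
  | monomial n a => exact fun m n h => by simpa using by gcongr

theorem combinedMachine_decidesInPolyTime (T : Transducer) {L : Fin 2 → Language Bool} (d : Bool)
    (h : ∀ i, (M i).DecidesInPolyTime (L i)) :
    (T.combinedMachine M d).DecidesInPolyTime
      {w | ∃ x, T.run w = some x ∧ junction d (x 0 ∈ L 0) (x 1 ∈ L 1)} := by
  choose q hq using fun i => NTM.decidesInPolyTime_iff.1 (h i)
  obtain ⟨B, hB⟩ := T.exists_length_le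
  let r : Polynomial ℕ := .C B * (.X + 1)
  refine machine_decidesInPolyTime ((q 0).comp r + (q 1).comp r + 2 * r + 4) fun w x hx => ?_
  have hlen (i : Fin 2) : (x i).length ≤ r.eval w.length := by simpa [r] using hB w x hx i
  have hM (i : Fin 2) : (M i).Decides (((q i).comp r).eval w.length)
      ((M i).init (x i).reverse.reverse) (x i ∈ L i) := by
    rw [List.reverse_reverse, Polynomial.eval_comp]
    exact (hq i (x i)).mono (monotone_eval _ (hlen i))
  have hsecond (s S) := decides_load (T := T) (d := d) (s := s) (S := S)
    (x := Function.update (fun i => (x i).reverse) 0 []) (Φ := id) (fun _ => Iff.rfl) (hM 1)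
    (decides_exit_one _ _ _)
  have hfirst := decides_load (T := T) (d := d) (s := fun i => (M i).tm.initialState)
    (S := fun _ _ => []) (x := fun i => (x i).reverse)
    (Φ := (junction d · (x 1 ∈ L 1))) (fun _ => exists_junction_iff d) (hM 0)
    (decides_exit_zero rfl rfl hsecond)
  rw [loading_eq rfl rfl] at hfirst
  refine hfirst.mono ?_
  simp only [Polynomial.eval_add, Polynomial.eval_mul, Polynomial.eval_ofNat, List.length_reverse]
  linarith [hlen 0, hlen 1]

theorem combinedMachine_deterministic (T : Transducer) (d : Bool)
    (h : ∀ i, (M i).Deterministic) : (T.combinedMachine M d).Deterministic := by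
  refine deterministic_machine (funext fun l => ?_)
  cases l with
  | run i l => exact congrArg (fun f => lift i (f l)) (h i)
  | load | exit => rfl

theorem setOf_junction_mem_classNP (T : Transducer) (d : Bool) {L : Fin 2 → Language Bool}
    (h : ∀ i, L i ∈ classNP) :
    ({w | ∃ x, T.run w = some x ∧ junction d (x 0 ∈ L 0) (x 1 ∈ L 1)} : Language Bool) ∈
      classNP := by
  choose M hM using h
  exact ⟨_, combinedMachine_decidesInPolyTime T d hM⟩

theorem setOf_junction_mem_classP (T : Transducer) (d : Bool) {L : Fin 2 → Language Bool}
    (h : ∀ i, L i ∈ classP) :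
    ({w | ∃ x, T.run w = some x ∧ junction d (x 0 ∈ L 0) (x 1 ∈ L 1)} : Language Bool) ∈
      classP := by
  choose M hM hL using h
  exact ⟨_, combinedMachine_deterministic T d hM, combinedMachine_decidesInPolyTime T d hL⟩

end Combination

end Transducer

/-! ### The iterated logarithm -/

/-- The number of times that `Nat.log 2` can be applied to `n` with a nonzero result. -/
def logStar (n : ℕ) : ℕ :=
  if h : Nat.log 2 n = 0 then 0
  else
    have : Nat.log 2 n < n := Nat.log_lt_self 2 (by rintro rfl; simp at h)
    logStar (Nat.log 2 n) + 1

theorem logStar_of_log_eq_zero {n : ℕ} (h : Nat.log 2 n = 0) : logStar n = 0 := by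
  rw [logStar, dif_pos h]

theorem logStar_of_log_ne_zero {n : ℕ} (h : Nat.log 2 n ≠ 0) :
    logStar n = logStar (Nat.log 2 n) + 1 := by
  rw [logStar, dif_neg h]

theorem two_mul_log_two_le {n : ℕ} (h : n ≠ 0) : 2 * Nat.log 2 n ≤ n := by
  refine le_trans ?_ (Nat.pow_log_le_self 2 h)
  rcases Nat.log 2 n with _ | j
  · simp
  · have := j.lt_two_pow_self
    rw [pow_succ]
    omega

namespace Transducer

open Statement

section LogStar

/-- The labels of the machine that computes `logStar` of the length of its input. -/
inductive LogLabel
  | halve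
  | check
  | refill (j : Option (Fin 2))
  deriving Fintype

/-- The program of the machine that decides whether `logStar n` has parity `b`, where `n` is the
initial height of the first buffer; the state holds the parity of the number of logarithms taken so
far. The second buffer collects half of the first one, and the input stack counts the halvings. -/
def logProgram (b : Bool) : LogLabel → Statement Empty.elim tally.Q LogLabel Bool
  | .halve =>
    popCase (some 0) fun
      | none => call .check
      | some _ => popCase (some 0) fun
        | none => call .check
        | some _ => .push (.bits (some 1)) (fun _ => true) (call .halve)
  | .check =>
    popCase (some 1) fun
      | some _ => .push (.bits (some 0)) (fun _ => true) <|
          .push (.bits none) (fun _ => true) (call (.refill (some 1)))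
      | none => popCase none fun
        | some _ => .push (.bits (some 0)) (fun _ => true) <|
            .load (fun s => (!s.1, s.2)) (call (.refill none))
        | none => .branch (fun s => s.1 = b) (verdict true) (verdict false)
  | .refill j =>
    popCase j fun
      | some _ => .push (.bits (some 0)) (fun _ => true) (call (.refill j))
      | none => call .halve

/-- The machine that decides whether `logStar` of the length of the input has parity `b`. -/
def logMachine (b : Bool) : NTM := tally.machine .halve false fun _ => logProgram b

/-- The stacks with heights `k` (input), `m` and `n` (buffers). -/
def heights (k m n : ℕ) : ∀ j : Stack Empty, List (Alphabet Empty.elim j) :=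
  contents (.replicate k true) ![.replicate m true, .replicate n true] fun _ => []

/-- The configuration at label `l`, where `p` is the parity so far. -/
def logConfig (l : LogLabel) (p : Bool) (k m n : ℕ) : Config Empty.elim tally.Q LogLabel Bool :=
  ⟨some (.body l), (p, none), heights k m n⟩

variable {b p : Bool}

theorem leadsTo_of_stepAux {l : LogLabel} {s : Bool × Option Bool}
    {S : ∀ k, List (Alphabet Empty.elim k)} {c : Config Empty.elim tally.Q LogLabel Bool}
    (h : TM2.stepAux (logProgram b l) s S = c) :
    (logMachine b).LeadsTo 1 ⟨some (.body l), s, S⟩ c :=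
  leadsTo_step (fun _ => h) (.refl _)

theorem leadsTo_halve_of_lt_two {m : ℕ} (hm : m < 2) (k n : ℕ) :
    (logMachine b).LeadsTo 1 (logConfig .halve p k m n) (logConfig .check p k 0 n) :=
  leadsTo_of_stepAux <| by
    interval_cases m <;> simp [logProgram, stepAux_popCase, logConfig, heights, contents]

theorem leadsTo_halve_add_two (k m n : ℕ) :
    (logMachine b).LeadsTo 1 (logConfig .halve p k (m + 2) n) (logConfig .halve p k m (n + 1)) :=
  leadsTo_of_stepAux <| by
    simp [logProgram, stepAux_popCase, logConfig, heights, contents, List.replicate_succ]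

theorem leadsTo_check_buffer (k n : ℕ) :
    (logMachine b).LeadsTo 1 (logConfig .check p k 0 (n + 1))
      (logConfig (.refill (some 1)) p (k + 1) 1 n) :=
  leadsTo_of_stepAux <| by
    simp [logProgram, stepAux_popCase, logConfig, heights, contents, List.replicate_succ]

theorem leadsTo_check_input (k : ℕ) :
    (logMachine b).LeadsTo 1 (logConfig .check p (k + 1) 0 0)
      (logConfig (.refill none) (!p) k 1 0) :=
  leadsTo_of_stepAux <| by
    simp [logProgram, stepAux_popCase, logConfig, heights, contents, List.replicate_succ]

theorem stepAux_check_zero :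
    TM2.stepAux (logProgram b .check) (p, none) (heights 0 0 0) =
      ⟨none, (p, some (p = b)), heights 0 0 0⟩ := by
  by_cases h : p = b <;> simp [logProgram, stepAux_popCase, heights, contents, verdict, h]

theorem leadsTo_halve (k m n : ℕ) :
    (logMachine b).LeadsTo (m / 2 + 1) (logConfig .halve p k m n)
      (logConfig .check p k 0 (n + m / 2)) := by
  induction m using Nat.twoStepInduction generalizing n with
  | zero => exact leadsTo_halve_of_lt_two two_pos ..
  | one => exact leadsTo_halve_of_lt_two one_lt_two ..
  | more m ih _ =>
    have hn : n + (m + 2) / 2 = n + 1 + m / 2 := by omega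
    rw [hn]
    exact ((leadsTo_halve_add_two k m n).trans (ih (n + 1))).mono (by omega)

theorem leadsTo_refill_buffer (k m n : ℕ) :
    (logMachine b).LeadsTo (n + 1) (logConfig (.refill (some 1)) p k m n)
      (logConfig .halve p k (n + m) 0) := by
  induction n generalizing m with
  | zero =>
    rw [Nat.zero_add m]
    exact leadsTo_of_stepAux (by simp [logProgram, stepAux_popCase, logConfig, heights, contents])
  | succ n ih =>
    have hstep : (logMachine b).LeadsTo 1 (logConfig (.refill (some 1)) p k m (n + 1))
        (logConfig (.refill (some 1)) p k (m + 1) n) := leadsTo_of_stepAux <| by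
      simp [logProgram, stepAux_popCase, logConfig, heights, contents, List.replicate_succ]
    rw [Nat.succ_add_eq_add_succ n m]
    exact (hstep.trans (ih (m + 1))).mono (by omega)

theorem leadsTo_refill_input (k m n : ℕ) :
    (logMachine b).LeadsTo (k + 1) (logConfig (.refill none) p k m n)
      (logConfig .halve p 0 (k + m) n) := by
  induction k generalizing m with
  | zero =>
    rw [Nat.zero_add m]
    exact leadsTo_of_stepAux (by simp [logProgram, stepAux_popCase, logConfig, heights, contents])
  | succ k ih =>
    have hstep : (logMachine b).LeadsTo 1 (logConfig (.refill none) p (k + 1) m n)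
        (logConfig (.refill none) p k (m + 1) n) := leadsTo_of_stepAux <| by
      simp [logProgram, stepAux_popCase, logConfig, heights, contents, List.replicate_succ]
    rw [Nat.succ_add_eq_add_succ k m]
    exact (hstep.trans (ih (m + 1))).mono (by omega)

theorem leadsTo_log (k m : ℕ) :
    (logMachine b).LeadsTo (4 * m + 2) (logConfig .halve p k m 0)
      (logConfig .check p (k + Nat.log 2 m) 0 0) := by
  induction m using Nat.strong_induction_on generalizing k with
  | _ m ih =>
    by_cases hm : m < 2
    · rw [Nat.log_of_lt hm]
      exact (leadsTo_halve_of_lt_two hm k 0).mono (by omega)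
    · obtain ⟨j, hj⟩ : ∃ j, m / 2 = j + 1 := Nat.exists_eq_add_one.2 (by omega)
      have hhalve := leadsTo_halve (b := b) (p := p) k m 0
      have hrec := ih (j + 1) (by omega) (k + 1)
      have hlog : k + 1 + Nat.log 2 (j + 1) = k + Nat.log 2 m := by
        rw [Nat.log_of_one_lt_of_le one_lt_two (le_of_not_gt hm), hj]
        omega
      rw [hj, Nat.zero_add] at hhalve
      rw [hlog] at hrec
      exact (hhalve.trans <| (leadsTo_check_buffer k j).trans <|
        (leadsTo_refill_buffer (k + 1) 1 j).trans hrec).mono (by omega)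

theorem decides_halve (p : Bool) (m : ℕ) :
    (logMachine b).Decides (12 * m + 10) (logConfig .halve p 0 m 0)
      ((p ^^ (logStar m).bodd) = b) := by
  induction m using Nat.strong_induction_on generalizing p with
  | _ m ih =>
    have hm := leadsTo_log (b := b) (p := p) 0 m
    rw [Nat.zero_add] at hm
    rcases h : Nat.log 2 m with _ | j
    · rw [h] at hm
      have hcheck : (logMachine b).Decides 1 (logConfig .check p 0 0 0) _ :=
        decides_step (fun _ => stepAux_check_zero) (decides_verdict ..)
      refine ((hm hcheck).mono (by omega)).congr ?_
      simp [logStar_of_log_eq_zero h]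
    · have hlog := two_mul_log_two_le (n := m) (by rintro rfl; simp at h)
      have hrec := ih (j + 1) (by omega) (!p)
      rw [h] at hm
      refine ((hm.trans ((leadsTo_check_input j).trans (leadsTo_refill_input j 1 0)) hrec).mono
        (by omega)).congr ?_
      simp [logStar_of_log_ne_zero (n := m) (by omega), h]

theorem setOf_bodd_logStar_eq_mem_classP (b : Bool) :
    ({w | (logStar w.length).bodd = b} : Language Bool) ∈ classP := by
  have hlang : ({w | (logStar w.length).bodd = b} : Language Bool) =
      {w | ∃ x, tally.run w = some x ∧ (logStar (x 0).length).bodd = b} := by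
    simp [run_tally]
  rw [hlang]
  refine ⟨logMachine b, deterministic_machine rfl,
    machine_decidesInPolyTime (.C 12 * .X + .C 10) fun w x hx => ?_⟩
  obtain rfl := Option.some.inj (hx.symm.trans (run_tally w))
  have hrev : (fun i => (![List.replicate w.length true, []] i).reverse) =
      ![List.replicate w.length true, []] := by
    funext i
    fin_cases i <;> simp
  rw [hrev]
  exact ((decides_halve false w.length).mono (by simp)).congr (by simp)

end LogStar

end Transducer

/-! ### Closure properties of the complexity classes -/

section Classes

variable {C : Set (Language Bool)} {L L' : Language Bool}

theorem mem_of_forall_mem_iff (hL : L ∈ C) (h : ∀ w, w ∈ L' ↔ w ∈ L) : L' ∈ C :=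
  Language.ext h ▸ hL

theorem pair_injective {x y x' y' : Str} (h : pair x y = pair x' y') : x = x' ∧ y = y' := by
  have hrun := Transducer.run_unpair_pair x y
  rw [h, Transducer.run_unpair_pair] at hrun
  have hxy := Option.some.inj hrun
  exact ⟨(congrFun hxy 0).symm, (congrFun hxy 1).symm⟩

theorem classP_subset_classNP : classP ⊆ classNP := fun _ ⟨M, _, hM⟩ => ⟨M, hM⟩

theorem sup_mem_classNP (hL : L ∈ classNP) (hL' : L' ∈ classNP) : L ⊔ L' ∈ classNP :=
  mem_of_forall_mem_iff (Transducer.copy.setOf_junction_mem_classNP true (L := ![L, L'])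
    (Fin.forall_fin_two.2 ⟨hL, hL'⟩)) fun w => by
    change _ ↔ ∃ x, Transducer.copy.run w = _ ∧ _
    simp only [Transducer.run_copy, Option.some.injEq, exists_eq_left']
    rfl

theorem inf_mem_classP (hL : L ∈ classP) (hL' : L' ∈ classP) : L ⊓ L' ∈ classP :=
  mem_of_forall_mem_iff (Transducer.copy.setOf_junction_mem_classP false (L := ![L, L'])
    (Fin.forall_fin_two.2 ⟨hL, hL'⟩)) fun w => by
    change _ ↔ ∃ x, Transducer.copy.run w = _ ∧ _
    simp only [Transducer.run_copy, Option.some.injEq, exists_eq_left']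
    rfl

theorem setOf_pair_mem_classP (hL : L ∈ classP) (z : Str) :
    ({w | pair w z ∈ L} : Language Bool) ∈ classP :=
  mem_of_forall_mem_iff ((Transducer.pairWith z).setOf_junction_mem_classP false
    (L := fun _ => L) fun _ => hL) fun w => by
    change _ ↔ ∃ x, (Transducer.pairWith z).run w = _ ∧ _
    simp only [Transducer.run_pairWith, Option.some.injEq, exists_eq_left']
    exact (and_self_iff).symm

theorem setOf_exists_pair_mem_classNP (hL : L ∈ classNP) (hL' : L' ∈ classNP) :
    ({w | ∃ x y, w = pair x y ∧ x ∈ L ∧ y ∈ L'} : Language Bool) ∈ classNP :=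
  mem_of_forall_mem_iff (Transducer.unpair.setOf_junction_mem_classNP false (L := ![L, L'])
    (Fin.forall_fin_two.2 ⟨hL, hL'⟩)) fun w => by
    change _ ↔ ∃ x, Transducer.unpair.run w = _ ∧ _
    simp only [Transducer.run_unpair_eq_some_iff]
    exact ⟨fun ⟨x, y, h⟩ => ⟨![x, y], h⟩, fun ⟨x, h⟩ => ⟨x 0, x 1, h⟩⟩

theorem langOf_bot_mem_classP : langOf ⊥ ∈ classP :=
  mem_of_forall_mem_iff Transducer.unpair.setOf_run_eq_mem_classP fun w => by
    change _ ↔ ∃ x, Transducer.unpair.run w = _ ∧ _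
    simp only [Transducer.run_unpair_eq_some_iff]
    exact ⟨fun ⟨x, y, h, hw⟩ => ⟨![x, y], hw, h⟩, fun ⟨x, hw, h⟩ => ⟨x 0, x 1, h, hw⟩⟩

theorem PEq_subset_NPEq : PEq ⊆ NPEq := fun _ h => classP_subset_classNP h

end Classes

/-! ### Growth of polynomial-time functions -/

section OutputLength

/-- The number of symbols that a statement pushes at most. -/
def pushCount {K Λ σ : Type*} {Γ : K → Type*} : TM2.Stmt Γ Λ σ → ℕ
  | .push _ _ q => pushCount q + 1
  | .peek _ _ q | .pop _ _ q | .load _ q => pushCount q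
  | .branch _ q₁ q₂ => max (pushCount q₁) (pushCount q₂)
  | .goto _ | .halt => 0

theorem length_stepAux_le {K Λ σ : Type*} [DecidableEq K] {Γ : K → Type*} (q : TM2.Stmt Γ Λ σ)
    (v : σ) (S : ∀ k, List (Γ k)) (k : K) :
    ((TM2.stepAux q v S).stk k).length ≤ (S k).length + pushCount q := by
  induction q generalizing v S with
  | push j f q ih =>
    refine (ih _ _).trans ?_
    rcases eq_or_ne k j with rfl | h
    · simp [pushCount, add_right_comm, ← add_assoc]
    · simp [pushCount, h]
  | pop j f q ih =>
    refine (ih _ _).trans ?_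
    rcases eq_or_ne k j with rfl | h
    · simp [pushCount]
    · simp [pushCount, h]
  | peek _ _ _ ih | load _ _ ih => exact ih _ _
  | branch f q₁ q₂ ih₁ ih₂ =>
    rw [TM2.stepAux, pushCount]
    cases f v
    · exact (ih₂ _ _).trans (Nat.add_le_add_left (le_max_right ..) _)
    · exact (ih₁ _ _).trans (Nat.add_le_add_left (le_max_left ..) _)
  | goto | halt => exact Nat.le_add_right ..

theorem exists_pushCount_le (M : FinTM2) : ∃ B, ∀ l, pushCount (M.m l) ≤ B := by
  have := M.ΛFin
  exact ⟨_, fun l => Finset.le_sup (f := fun l => pushCount (M.m l)) (Finset.mem_univ l)⟩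

theorem length_iterate_step_le {M : FinTM2} {B : ℕ} (hB : ∀ l, pushCount (M.m l) ≤ B) (k : M.K)
    {n : ℕ} {c d : M.Cfg} (h : (flip bind M.step)^[n] (some c) = some d) :
    (d.stk k).length ≤ (c.stk k).length + n * B := by
  induction n generalizing d with
  | zero =>
    cases h
    exact Nat.le_add_right ..
  | succ n ih =>
    rw [Function.iterate_succ_apply'] at h
    obtain ⟨⟨_ | l, v, S⟩, he, hd⟩ := Option.bind_eq_some_iff.1 h
    · cases hd
    · cases hd
      calc ((TM2.stepAux (M.m l) v S).stk k).length
          ≤ (S k).length + pushCount (M.m l) := length_stepAux_le ..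
        _ ≤ (c.stk k).length + n * B + B := Nat.add_le_add (ih he) (hB l)
        _ = (c.stk k).length + (n + 1) * B := by ring

theorem length_initList_le (M : FinTM2) (s : List (M.Γ M.k₀)) (k : M.K) :
    ((initList M s).stk k).length ≤ s.length := by
  rw [initList]
  rcases eq_or_ne k M.k₀ with rfl | h
  · simp
  · simp [h]

theorem exists_polynomial_length_le {α β αΓ βΓ : Type} {ea : α → List αΓ} {eb : β → List βΓ}
    {f : α → β} (M : TM2ComputableInPolyTime ea eb f) :
    ∃ q : Polynomial ℕ, ∀ a, (eb (f a)).length ≤ q.eval (ea a).length := by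
  obtain ⟨B, hB⟩ := exists_pushCount_le M.tm
  refine ⟨.X + M.time * .C B, fun a => ?_⟩
  let out := (eb (f a)).map M.outputAlphabet.invFun
  let inp := (ea a).map M.inputAlphabet.invFun
  calc (eb (f a)).length
      = ((haltList M.tm out).stk M.tm.k₁).length := by simp [haltList, out]
    _ ≤ ((initList M.tm inp).stk M.tm.k₁).length + (M.outputsFun a).steps * B :=
        length_iterate_step_le hB _ (M.outputsFun a).evals_in_steps
    _ ≤ (ea a).length + M.time.eval (ea a).length * B :=
        Nat.add_le_add ((length_initList_le ..).trans_eq (List.length_map _))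
          (Nat.mul_le_mul_right B (M.outputsFun a).steps_le_m)
    _ = (.X + M.time * .C B : Polynomial ℕ).eval (ea a).length := by simp

end OutputLength

section Growth

/-- The towers `1, 2, 2 ^ 2, 2 ^ 2 ^ 2, …`; on positive numbers, `logStar` takes the value `i` from
`tower i` up to `tower (i + 1)`, exclusively. -/
def tower : ℕ → ℕ
  | 0 => 1
  | i + 1 => 2 ^ tower i

theorem lt_tower : ∀ i, i < tower i
  | 0 => one_pos
  | i + 1 => (Nat.succ_le_of_lt (lt_tower i)).trans_lt Nat.lt_two_pow_self

theorem logStar_eq {i n : ℕ} (h : tower i ≤ n) (h' : n < tower (i + 1)) : logStar n = i := by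
  induction i generalizing n with
  | zero => exact logStar_of_log_eq_zero (Nat.log_of_lt h')
  | succ i ih =>
    have hn : n ≠ 0 := (Nat.zero_lt_of_lt (lt_tower (i + 1))).trans_le h |>.ne'
    have hle : tower i ≤ Nat.log 2 n := Nat.le_log_of_pow_le one_lt_two h
    have hlog : Nat.log 2 n ≠ 0 := ((Nat.zero_lt_of_lt (lt_tower i)).trans_le hle).ne'
    rw [logStar_of_log_ne_zero hlog, ih hle (Nat.log_lt_of_lt_pow hn h')]

theorem exists_forall_bodd_logStar_eq (N : ℕ) (b : Bool) :
    ∃ m ≥ N, ∀ n, m ≤ n → n < 2 ^ m → (logStar n).bodd = b := by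
  obtain ⟨i, hi, rfl⟩ : ∃ i ≥ N, i.bodd = b := by
    rcases eq_or_ne N.bodd b with h | h
    · exact ⟨N, le_rfl, h⟩
    · exact ⟨N + 1, N.le_succ, by rw [Nat.bodd_succ, Bool.not_eq.2 h]⟩
  exact ⟨tower i, hi.trans (lt_tower i).le, fun n h h' => congrArg Nat.bodd (logStar_eq h h')⟩

theorem exists_bodd_logStar_length_eq (b : Bool) : ∃ w : Str, (logStar w.length).bodd = b := by
  obtain ⟨m, -, hm⟩ := exists_forall_bodd_logStar_eq 0 b
  exact ⟨.replicate m true, by rw [List.length_replicate, hm m le_rfl m.lt_two_pow_self]⟩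

open Filter Asymptotics

theorem isLittleO_eval_const_pow (p : Polynomial ℝ) {r : ℝ} (hr : 1 < r) :
    (fun n : ℕ => p.eval (n : ℝ)) =o[atTop] fun n : ℕ => r ^ n := by
  induction p using Polynomial.induction_on' with
  | add p q hp hq => simpa only [Polynomial.eval_add] using hp.add hq
  | monomial n a =>
    simpa only [Polynomial.eval_monomial] using
      (isLittleO_pow_const_const_pow_of_one_lt n hr).const_mul_left a

theorem eventually_eval_lt_pow (q : Polynomial ℕ) {b : ℕ} (hb : 1 < b) :
    ∀ᶠ n in atTop, q.eval n < b ^ n := by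
  have h := isLittleO_eval_const_pow (q.map (Nat.castRingHom ℝ)) (r := b) (by exact_mod_cast hb)
  filter_upwards [h.def one_half_pos] with n hn
  have hpos : 0 < (b : ℝ) ^ n := by positivity
  rw [Polynomial.eval_natCast_map, eq_natCast, Real.norm_natCast, Nat.cast_id,
    Real.norm_of_nonneg hpos.le] at hn
  have hlt : ((q.eval n : ℕ) : ℝ) < b ^ n := hn.trans_lt (by linarith)
  exact_mod_cast hlt

end Growth

/-! ### Collapsing a set of strings -/

section Collapse

/-- The equivalence relation all of whose classes are singletons, except for the class `C`. -/
def collapse {α : Type*} (C : Set α) : Setoid α where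
  r x y := x = y ∨ x ∈ C ∧ y ∈ C
  iseqv := ⟨fun _ => .inl rfl, by grind, by grind⟩

theorem collapse_mem_NPEq {C : Language Bool} (hC : C ∈ classNP) : collapse C ∈ NPEq :=
  mem_of_forall_mem_iff (sup_mem_classNP (classP_subset_classNP langOf_bot_mem_classP)
    (setOf_exists_pair_mem_classNP hC hC)) fun w => by
    constructor
    · rintro ⟨x, y, hxy | hxy, hw⟩
      exacts [.inl ⟨x, y, hxy, hw⟩, .inr ⟨x, y, hw, hxy⟩]
    · rintro (⟨x, y, hxy, hw⟩ | ⟨x, y, hw, hxy⟩)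
      exacts [⟨x, y, .inl hxy, hw⟩, ⟨x, y, .inr hxy, hw⟩]

theorem mem_classP_of_collapse_mem_PEq {C : Language Bool} (hC : (C : Set Str).Nonempty)
    (h : collapse C ∈ PEq) : C ∈ classP := by
  obtain ⟨z, hz⟩ := hC
  refine mem_of_forall_mem_iff (setOf_pair_mem_classP h z) fun w => ⟨?_, ?_⟩
  · exact fun hw => ⟨w, z, .inr ⟨hw, hz⟩, rfl⟩
  · rintro ⟨x, y, hxy, hw⟩
    obtain ⟨rfl, rfl⟩ := pair_injective hw
    rcases hxy with rfl | hxy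
    exacts [hz, hxy.1]

theorem ncard_setOf_length_eq (n : ℕ) : {w : Str | w.length = n}.ncard = 2 ^ n := by
  rw [← Nat.card_coe_set_eq]
  exact (Nat.card_eq_fintype_card (α := List.Vector Bool n)).trans (card_vector n)

theorem ncard_setOf_length_lt (m : ℕ) : {w : Str | w.length < m}.ncard + 1 = 2 ^ m := by
  induction m with
  | zero => simp
  | succ m ih =>
    have hunion : {w : Str | w.length < m + 1} = {w | w.length < m} ∪ {w | w.length = m} := by
      ext w
      exact Nat.lt_succ_iff_lt_or_eq
    rw [hunion, Set.ncard_union_eq _ (List.finite_length_lt Bool m) (List.finite_length_eq Bool m),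
      ncard_setOf_length_eq, add_right_comm, ih, pow_succ, mul_two]
    exact Set.disjoint_left.2 fun w h h' => h.ne h'

theorem exists_le_length_notMem {f : Str → Str} (hf : f.Injective) {C : Set Str}
    (hC : (f ⁻¹' C).Subsingleton) (m : ℕ) :
    ∃ x, x.length = m + 1 ∧ m ≤ (f x).length ∧ f x ∉ C := by
  by_contra! h
  have hsub : {x : Str | x.length = m + 1} ⊆ f ⁻¹' {w | w.length < m} ∪ f ⁻¹' C := fun x hx =>
    (lt_or_ge (f x).length m).imp id (h x hx)
  have hfin := (List.finite_length_lt Bool m).preimage hf.injOn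
  have hcard := (Set.ncard_le_ncard hsub (hfin.union hC.finite)).trans (Set.ncard_union_le _ _)
  have hshort : (f ⁻¹' {w | w.length < m}).ncard ≤ {w : Str | w.length < m}.ncard :=
    Set.ncard_le_ncard_of_injOn f (fun _ => id) hf.injOn (List.finite_length_lt Bool m)
  have hlong : (f ⁻¹' C).ncard ≤ 1 := (Set.ncard_le_one hC.finite).2 fun _ hx _ hy => hC hx hy
  have := ncard_setOf_length_lt m
  rw [ncard_setOf_length_eq, pow_succ] at hcard
  omega

theorem not_polyKernelReduces_bot_collapse {C : Set Str} {b : Bool}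
    (hC : ∀ w : Str, (logStar w.length).bodd = b → w ∈ C) :
    ¬ PolyKernelReduces ⊥ (collapse C) := by
  rintro ⟨f, ⟨M⟩, hf⟩
  have hinj : f.Injective := fun x y hxy => (hf x y).2 (.inl hxy)
  have hfiber : (f ⁻¹' C).Subsingleton := fun x hx y hy => (hf x y).2 (.inr ⟨hx, hy⟩)
  obtain ⟨q, hq⟩ := exists_polynomial_length_le M
  obtain ⟨N, hN⟩ := Filter.eventually_atTop.1 (eventually_eval_lt_pow (q.comp (.X + 1)) one_lt_two)
  obtain ⟨m, hm, hb⟩ := exists_forall_bodd_logStar_eq N b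
  obtain ⟨x, hx, hle, hxC⟩ := exists_le_length_notMem hinj hfiber m
  refine hxC (hC _ (hb _ hle ((hq x).trans_lt ?_)))
  simpa [hx] using hN m hm

end Collapse

end KernelReduction

open KernelReduction in
theorem mainTheorem4_general (h : classP ≠ classNP) :
    ∃ R : Setoid Str, R ∈ NPEq ∧ R ∉ PEq ∧ ¬ IsHard PEq R := by
  obtain ⟨L, hL, hLP⟩ := Set.exists_of_ssubset (classP_subset_classNP.ssubset_of_ne h)
  let B (b : Bool) : Language Bool := {w | (logStar w.length).bodd = b}
  have hB (b : Bool) : B b ∈ classP := Transducer.setOf_bodd_logStar_eq_mem_classP b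
  obtain ⟨b, hb⟩ : ∃ b, B b ⊔ L ∉ classP := by
    by_contra! hP
    refine hLP (mem_of_forall_mem_iff (inf_mem_classP (hP true) (hP false)) fun w => ?_)
    change _ ↔ (_ = true ∨ w ∈ L) ∧ (_ = false ∨ w ∈ L)
    cases (logStar w.length).bodd <;> simp
  refine ⟨collapse (B b ⊔ L), ?_, fun hR => hb ?_, fun hhard => ?_⟩
  · exact collapse_mem_NPEq (sup_mem_classNP (classP_subset_classNP (hB b)) hL)
  · exact mem_classP_of_collapse_mem_PEq
      ((exists_bodd_logStar_length_eq b).imp fun _ => .inl) hR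
  · exact not_polyKernelReduces_bot_collapse (fun w => .inl) (hhard ⊥ langOf_bot_mem_classP)

theorem mainTheorem4 (h : KernelReduction.PEq ≠ KernelReduction.NPEq) :
    ∃ R : Setoid KernelReduction.Str,
      R ∈ KernelReduction.NPEq ∧ R ∉ KernelReduction.PEq ∧
        ¬ KernelReduction.IsComplete KernelReduction.NPEq R := by
  obtain ⟨R, hR, hRP, hhard⟩ := mainTheorem4_general (ne_of_apply_ne KernelReduction.eqClass h)
  exact ⟨R, hR, hRP, fun hc => hhard fun S hS => hc.2 S (KernelReduction.PEq_subset_NPEq hS)⟩
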